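/- There is a polynomial $P(x,y)$ with coefficients in $\mathbb N$ such that the following holds. Let $A=(S,\Sigma,\delta_A,q_0,F_A)$ be a one-way nondeterministic finite automaton with $n=|S|$ states, finite input alphabet $\Sigma$, a single initial state $q_0$ and transition function $\delta_A:S\times\Sigma\to 2^S$. Then there is a weight-reducing Hennie machine $M$ with input alphabet $\Sigma$ and size at most $P(n,|\Sigma|)$ (thus, for a fixed input alphabet, of size polynomial in $n$) such that, for every $w\in\Sigma^*$ with $|w|\ge n$, $M$ accepts $w$ if and only if $A$ accepts $w$. Here a deterministic one-tape Turing machine consists of a finite set of states $Q$, a finite working alphabet $\Gamma\supseteq\Sigma$ containing a blank symbol not in $\Sigma$ that is never written, an initial state, a set of final states and a partial transition function $\delta:Q\times\Gamma\rightharpoonup Q\times\Gamma\times\{-1,+1\}$ (new state, written symbol, head move). It is *end-marked* if $\Gamma$ contains two distinct further symbols $\vdash,\dashv$ (neither blank nor in $\Sigma$) such that every transition reading $\vdash$ (respectively $\dashv$) writes it back and moves the head right (respectively left). The computation of an end-marked machine on $w$ starts in the initial state on the tape content ${\vdash}w{\dashv}$ with the head on $\vdash$; $w$ is accepted if the machine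 eventually halts (no transition applies) in a final state. A *Hennie machine* is an end-marked machine that halts on every input $w$ within $O(|w|+1)$ steps. It is *weight-reducing* if there is a strict partial order $<$ on $\Gamma\setminus\{\vdash,\dashv\}$ such that $\delta(p,\sigma)=(q,\tau,d)$ with $\sigma\notin\{\vdash,\dashv\}$ implies $\tau\in\Gamma\setminus\{\vdash,\dashv\}$ and $\tau<\sigma$. The *size* of a machine is the number of symbols of its description by a full transition table, namely $|Q|\,|\Gamma|\,(2+\lceil\log_2|Q|\rceil+\lceil\log_2|\Gamma|\rceil)+\lceil\log_2|Q|\rceil+|Q|+|\Gamma|$, which is $\Theta(|Q|\,|\Gamma|\log(|Q|\,|\Gamma|))$. -/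

import Mathlib

/-- Head moves of a one-tape machine. -/
inductive HeadMove where
  | left
  | right

/-- The displacement of the head caused by a move. -/
def HeadMove.offset : HeadMove → ℤ
  | .left => -1
  | .right => 1

/-- A deterministic one-tape Turing machine with input alphabet `α`, set of states `Q` and working
alphabet `Γ`, which includes `α` (through the injection `input`) and a blank symbol. The transition
function is partial, and the blank symbol cannot be written. -/
structure DetTM (α Q Γ : Type*) where
  input : α ↪ Γ
  blank : Γ
  blank_ne_input : ∀ a, input a ≠ blank
  start : Q
  final : Set Q
  δ : Q → Γ → Option (Q × Γ × HeadMove)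
  write_ne_blank : ∀ p σ q τ d, δ p σ = some (q, τ, d) → τ ≠ blank

namespace DetTM

/-- A configuration: current state, contents of the bi-infinite tape, position of the head. -/
structure Config (Q Γ : Type*) where
  state : Q
  tape : ℤ → Γ
  head : ℤ

variable {α Q Γ : Type*}

/-- The successor of a configuration, if there is one. -/
def step (M : DetTM α Q Γ) (c : Config Q Γ) : Option (Config Q Γ) :=
  (M.δ c.state (c.tape c.head)).map fun t =>
    ⟨t.1, Function.update c.tape c.head t.2.1, c.head + t.2.2.offset⟩

/-- A halting configuration is one without successor. -/
def Halting (M : DetTM α Q Γ) (c : Config Q Γ) : Prop :=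
  M.step c = none

/-- `M.ReachesIn t c d`: the machine goes from `c` to `d` in exactly `t` steps. -/
inductive ReachesIn (M : DetTM α Q Γ) : ℕ → Config Q Γ → Config Q Γ → Prop
  | refl (c : Config Q Γ) : ReachesIn M 0 c c
  | tail {t : ℕ} {c d e : Config Q Γ} :
      ReachesIn M t c d → M.step d = some e → ReachesIn M (t + 1) c e

/-- The configuration in the initial state in which the tape holds the string `x` in cells
`0, …, |x| - 1` and is blank elsewhere, with the head on cell `0`. -/
def configOn (M : DetTM α Q Γ) (x : List Γ) : Config Q Γ where
  state := M.start
  tape := fun i => if 0 ≤ i then x.getD i.toNat M.blank else M.blank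
  head := 0

/-- The number of symbols in a description of the machine: for each pair of a state and a working
symbol, a flag telling whether the transition is defined, a flag for the head move, and the binary
indices of the new state and the written symbol; the index of the initial state; for each state, a
flag telling whether it is final; for each working symbol, a mark telling its role (input symbol,
blank, left endmarker, right endmarker, or other). -/
def size [Fintype Q] [Fintype Γ] (_M : DetTM α Q Γ) : ℕ :=
  Fintype.card Q * Fintype.card Γ *
      (2 + Nat.clog 2 (Fintype.card Q) + Nat.clog 2 (Fintype.card Γ))
    + Nat.clog 2 (Fintype.card Q) + Fintype.card Q + Fintype.card Γ

end DetTM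

/-- An end-marked deterministic Turing machine: two distinct working symbols, which are neither
input symbols nor blank, are the endmarkers. They are never overwritten, the head moves right from
the left endmarker and left from the right endmarker. -/
structure EndMarkedTM (α Q Γ : Type*) extends DetTM α Q Γ where
  lend : Γ
  rend : Γ
  lend_ne_rend : lend ≠ rend
  lend_ne_blank : lend ≠ blank
  rend_ne_blank : rend ≠ blank
  lend_ne_input : ∀ a, input a ≠ lend
  rend_ne_input : ∀ a, input a ≠ rend
  at_lend : ∀ p q τ d, δ p lend = some (q, τ, d) → τ = lend ∧ d = HeadMove.right
  at_rend : ∀ p q τ d, δ p rend = some (q, τ, d) → τ = rend ∧ d = HeadMove.left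

namespace EndMarkedTM

variable {α Q Γ : Type*}

/-- The initial configuration on input `w`: the tape contains `w` surrounded by the endmarkers, and
the head scans the left endmarker. -/
def init (M : EndMarkedTM α Q Γ) (w : List α) : DetTM.Config Q Γ :=
  M.configOn (M.lend :: (w.map M.input ++ [M.rend]))

/-- The input `w` is accepted if the computation on it halts in a final state. -/
def Accepts (M : EndMarkedTM α Q Γ) (w : List α) : Prop :=
  ∃ t c, M.ReachesIn t (M.init w) c ∧ M.Halting c ∧ c.state ∈ M.final

/-- Linear time: on every input `w` (also the empty one), the computation halts within
`O(|w| + 1)` steps. -/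
def LinearTime (M : EndMarkedTM α Q Γ) : Prop :=
  ∃ k : ℕ, ∀ w : List α, ∃ t c, t ≤ k * (w.length + 1) ∧ M.ReachesIn t (M.init w) c ∧ M.Halting c

/-- A Hennie machine is an end-marked machine working in linear time. -/
def IsHennie (M : EndMarkedTM α Q Γ) : Prop :=
  M.LinearTime

/-- The working symbols other than the endmarkers. -/
def Inner (M : EndMarkedTM α Q Γ) : Type _ :=
  {σ : Γ // σ ≠ M.lend ∧ σ ≠ M.rend}

/-- There is a (strict) partial order on the working symbols other than the endmarkers such that
each rewriting of such a symbol produces a smaller one. -/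
def WeightReducing (M : EndMarkedTM α Q Γ) : Prop :=
  ∃ r : M.Inner → M.Inner → Prop, IsStrictOrder M.Inner r ∧
    ∀ (p : Q) (σ : M.Inner) (q : Q) (τ : Γ) (d : HeadMove),
      M.δ p σ.1 = some (q, τ, d) → ∃ τ' : M.Inner, τ'.1 = τ ∧ r τ' σ

/-- A weight-reducing Hennie machine. -/
def IsWeightReducingHennie (M : EndMarkedTM α Q Γ) : Prop :=
  M.IsHennie ∧ M.WeightReducing

end EndMarkedTM

/-! This is the subset construction with the subset kept on the tape instead of in the control. The
`n` bits of the set of reached states occupy `n` consecutive cells, a window that travels with the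
current letter. For a letter `a` the new bits are found one target state `t` at a time: a sweep over
the window forms the disjunction of (bit of `s`) ∧ (`t` is an `a`-successor of `s`), and the sweep
back stores it on a second track. The control needs only a letter, three numbers up to `n + 1` and a
few flags. The first window is cells `1, …, n`, which exist because `n ≤ |w|`.

A phase (one letter) takes `O(n²)` steps and a cell meets `O(n)` phases, so a cell is visited
`O(n³)` times. A counter of that size in each cell, lowered at every visit, makes the machine
weight-reducing without growing the alphabet beyond a polynomial. The total weight bounds the
running time on every input, including short words, where the simulation may be meaningless.

`run_phase` proves the sweeps correct without counters, `Refines.run` and `reaches_ready` show that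
the counters suffice, and `Reduces.isWeightReducingHennie` gives linear time. -/

/-- A nondeterministic automaton with states `0, …, n - 1` and letters `0, …, m - 1`, given by
Boolean tables. -/
structure NFATable where
  n : ℕ
  m : ℕ
  q₀ : ℕ
  T : ℕ → ℕ → ℕ → Bool
  F : ℕ → Bool

/-- The disjunction of `f 0, …, f (k - 1)`. -/
def orBelow (f : ℕ → Bool) : ℕ → Bool
  | 0 => false
  | k + 1 => orBelow f k || f k

theorem orBelow_eq_true {f : ℕ → Bool} {k : ℕ} : orBelow f k = true ↔ ∃ s < k, f s = true := by
  induction k with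
  | zero => simp [orBelow]
  | succ k ih =>
    rw [orBelow, Bool.or_eq_true, ih]
    constructor
    · rintro (⟨s, hs, h⟩ | h)
      · exact ⟨s, by omega, h⟩
      · exact ⟨k, by omega, h⟩
    · rintro ⟨s, hs, h⟩
      rcases Nat.lt_succ_iff_lt_or_eq.1 hs with h1 | rfl
      · exact Or.inl ⟨s, h1, h⟩
      · exact Or.inr h

theorem orBelow_congr {f g : ℕ → Bool} {k : ℕ} (h : ∀ s < k, f s = g s) :
    orBelow f k = orBelow g k := by
  induction k with
  | zero => rfl
  | succ k ih => rw [orBelow, orBelow, ih fun s hs => h s (by omega), h k (by omega)]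

/-- The characteristic function of the set of states reached after `i` letters of `x 1, x 2, …`. -/
def NFATable.reach (D : NFATable) (x : ℕ → ℕ) : ℕ → ℕ → Bool
  | 0 => fun s => s == D.q₀
  | i + 1 => fun t => orBelow (fun s => D.reach x i s && D.T (x (i + 1)) s t) D.n

/-! ### The sweeping procedure, without counters -/

namespace SweepMachine

/-- `go` seeks the next letter, `fwd` collects the successors over the window from left to right,
`back` returns to the left end of the window and stores the bit collected. -/
inductive Mode
  | go
  | fwd
  | back
  deriving DecidableEq

instance : Fintype Mode :=
  ⟨([.go, .fwd, .back] : List Mode).toFinset, fun m => by cases m <;> simp⟩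

/-- The control state. The window consists of the positions `1, …, n`, position `s + 1` holding the
bit of state `s`; the current letter is at position `width + 1`. -/
structure Control where
  mode : Mode
  width : ℕ
  pos : ℕ
  row : ℕ
  letter : ℕ
  acc : Bool
  par : Bool
  flag : Bool

/-- The displacement of the window after a letter is processed. -/
def shift (D : NFATable) (width : ℕ) : ℕ := if width = D.n then 1 else 0

/-- Store the collected bit for the state `row - 1`, at the position where it belongs. -/
def store (D : NFATable) (r : Control) (row : ℕ) (b : Bool → Bool) : Bool → Bool :=
  -- In row `0` no bit has been collected yet. If the window is about to shift, the bit goes one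
  -- cell further right, to its position in the next window.
  if 0 < row ∧ row + shift D r.width = r.pos then Function.update b (!r.par) r.acc else b

/-- The transition at a cell with letter `x` and bits `b`. -/
def act (D : NFATable) (r : Control) (x : ℕ) (b : Bool → Bool) :
    Control × (Bool → Bool) × HeadMove :=
  match r.mode with
  | .go =>
    if r.pos = r.width + 1 then
      ({ r with mode := .back, pos := r.pos - 1, row := 0, letter := x, flag := false }, b, .left)
    else ({ r with pos := r.pos + 1 }, b, .right)
  | .fwd =>
    if r.pos ≤ D.n then
      ({ r with
          pos := r.pos + 1
          -- At the first letter no bits are on the tape yet; the initial set is read off from the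
          -- position.
          acc := r.acc || ((if r.width = 0 then r.pos - 1 == D.q₀ else b r.par) &&
            D.T r.letter (r.pos - 1) r.row) }, b, .right)
    else
      ({ r with
          mode := .back
          pos := D.n
          row := r.row + 1
          flag := r.flag || (r.acc && D.F r.row) }, store D r (r.row + 1) b, .left)
  | .back =>
    if r.pos = 0 then
      if r.row = D.n then
        ({ mode := .go
           width := min (r.width + 1) D.n
           -- The head enters cell `1` of the old window, which is cell `0` of a shifted one.
           pos := 1 - shift D r.width
           row := 0
           letter := 0
           acc := false
           par := !r.par
           flag := r.flag }, b, .right)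
      else ({ r with mode := .fwd, pos := 1, acc := false }, b, .right)
    else ({ r with pos := r.pos - 1 }, store D r r.row b, .left)

/-- A configuration without the counters. -/
structure Sketch where
  ctl : Control
  bits : ℕ → Bool → Bool
  head : ℕ

/-- The position reached by a head move. -/
def moved : HeadMove → ℕ → ℕ
  | .left, h => h - 1
  | .right, h => h + 1

/-- The successor of a sketch. -/
def next (D : NFATable) (x : ℕ → ℕ) (A : Sketch) : Sketch where
  ctl := (act D A.ctl (x A.head) (A.bits A.head)).1
  bits := Function.update A.bits A.head (act D A.ctl (x A.head) (A.bits A.head)).2.1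
  head := moved (act D A.ctl (x A.head) (A.bits A.head)).2.2 A.head

/-- The control states that are represented in the finite machine. -/
structure Bounded (D : NFATable) (r : Control) : Prop where
  width : r.width ≤ D.n
  pos : r.pos ≤ D.n + 1
  row : r.row ≤ D.n
  letter : r.letter ≤ D.m

/-- The step from `A` is executed on a tape with inner cells `1, …, L`, and the head is between
`lo` and `hi`. -/
structure Ok (D : NFATable) (L lo hi : ℕ) (A : Sketch) : Prop where
  lo_le : lo ≤ A.head
  le_hi : A.head ≤ hi
  le_end : A.head ≤ L + 1
  bounded : Bounded D A.ctl
  -- In the situations allowed at the two ends, the new control and the move do not depend on the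
  -- letter or the bits, so an end-marker can stand in for a cell.
  at_zero : A.head = 0 → A.ctl.pos = 0 ∧ A.ctl.mode ≠ .fwd
  at_end : A.head = L + 1 → A.ctl.mode = .fwd ∧ D.n < A.ctl.pos

/-! ### Correctness of the sweeps -/

/-- Runs on sketches. -/
inductive Run (D : NFATable) (x : ℕ → ℕ) (L lo hi : ℕ) : ℕ → Sketch → Sketch → Prop
  | refl (A : Sketch) : Run D x L lo hi 0 A A
  | tail {s : ℕ} {A B C : Sketch} :
      Run D x L lo hi s A B → Ok D L lo hi B → next D x B = C → Run D x L lo hi (s + 1) A C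

variable {D : NFATable} {x : ℕ → ℕ} {L lo hi : ℕ}

theorem Run.single {A B : Sketch} (hA : Ok D L lo hi A) (h : next D x A = B) :
    Run D x L lo hi 1 A B :=
  .tail (.refl A) hA h

theorem Run.trans {s t : ℕ} {A B C : Sketch} (h₁ : Run D x L lo hi s A B)
    (h₂ : Run D x L lo hi t B C) : Run D x L lo hi (s + t) A C := by
  induction h₂ with
  | refl => exact h₁
  | tail _ hB hC ih => exact .tail (ih h₁) hB hC

/-- Adjust the step count and the last sketch of a run. -/
theorem Run.cast {s t : ℕ} {A B C : Sketch} (h : Run D x L lo hi s A B) (hs : s = t)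
    (hB : B = C) : Run D x L lo hi t A C := hs ▸ hB ▸ h

/-- In mode `back` the head sweeps to the left of the window. -/
theorem run_back {base : ℕ} {e t a : ℕ} {acc par flag : Bool} (he : e ≤ D.n) (ht : t ≤ D.n)
    (ha : a ≤ D.m) (o : ℕ) (β : ℕ → Bool → Bool) (ho : o ≤ D.n + 1) (hL : base + o ≤ L) :
    Run D x L base (base + D.n + 1) o
      ⟨⟨.back, e, o, t, a, acc, par, flag⟩, β, base + o⟩
      ⟨⟨.back, e, 0, t, a, acc, par, flag⟩,
        if 0 < t ∧ t + shift D e ≤ o then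
          Function.update β (base + (t + shift D e))
            (Function.update (β (base + (t + shift D e))) (!par) acc)
        else β, base⟩ := by
  induction o generalizing β with
  | zero =>
    have : ¬ (0 < t ∧ t + shift D e ≤ 0) := by omega
    rw [if_neg this]
    exact .refl _
  | succ o ih =>
    have h1 : Run D x L base (base + D.n + 1) 1
        ⟨⟨.back, e, o + 1, t, a, acc, par, flag⟩, β, base + (o + 1)⟩
        ⟨⟨.back, e, o, t, a, acc, par, flag⟩,
          Function.update β (base + (o + 1)) (if 0 < t ∧ t + shift D e = o + 1 then
            Function.update (β (base + (o + 1))) (!par) acc else β (base + (o + 1))), base + o⟩ := by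
      refine .single ⟨?_, ?_, ?_, ⟨he, ho, ht, ha⟩, ?_, ?_⟩ ?_
      · simp
      · simp; omega
      · simp; omega
      · simp
      · simp; omega
      · simp [next, act, store, moved, ← add_assoc]
    refine (h1.trans (ih _ (by omega) (by omega))).cast (by omega) ?_
    congr 1
    by_cases h : 0 < t ∧ t + shift D e = o + 1
    · rw [if_neg (by omega), if_pos h, if_pos (by omega), h.2]
    · rw [if_neg h, Function.update_eq_self]
      by_cases h' : 0 < t ∧ t + shift D e ≤ o
      · rw [if_pos h', if_pos (by omega)]
      · rw [if_neg h', if_neg (by omega)]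

/-- The bit of state `s` before the current letter. -/
def old (D : NFATable) (e base : ℕ) (β : ℕ → Bool → Bool) (par : Bool) (s : ℕ) : Bool :=
  if e = 0 then s == D.q₀ else β (base + (s + 1)) par

/-- In mode `fwd` the head sweeps to the right of the window. -/
theorem run_fwd {base : ℕ} {e t a : ℕ} {par flag : Bool} (he : e ≤ D.n) (ht : t ≤ D.n)
    (ha : a ≤ D.m) (β : ℕ → Bool → Bool) (hL : base + D.n ≤ L) (k : ℕ) (hk : k ≤ D.n) :
    Run D x L base (base + D.n + 1) k
      ⟨⟨.fwd, e, 1, t, a, false, par, flag⟩, β, base + 1⟩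
      ⟨⟨.fwd, e, k + 1, t, a, orBelow (fun s => old D e base β par s && D.T a s t) k, par, flag⟩,
        β, base + (k + 1)⟩ := by
  induction k with
  | zero => exact .refl _
  | succ k ih =>
    refine .tail (ih (by omega)) ⟨?_, ?_, ?_, ⟨he, ?_, ht, ha⟩, ?_, ?_⟩ ?_
    · simp
    · simp; omega
    · simp; omega
    · simp; omega
    · simp
    · simp; omega
    · have : k + 1 ≤ D.n := hk
      simp [next, act, moved, orBelow, old, this]; omega

/-- In mode `go` the head moves to the right until the current letter. -/
theorem run_go {base : ℕ} {e o : ℕ} {par flag : Bool} (he : e ≤ D.n)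
    (β : ℕ → Bool → Bool) (k : ℕ) (hk : o + k ≤ e + 1) (hL : base + o + k ≤ L + 1)
    (hlo : lo ≤ base + o) (hhi : base + o + k ≤ hi + 1) :
    Run D x L lo hi k
      ⟨⟨.go, e, o, 0, 0, false, par, flag⟩, β, base + o⟩
      ⟨⟨.go, e, o + k, 0, 0, false, par, flag⟩, β, base + o + k⟩ := by
  induction k with
  | zero => exact .refl _
  | succ k ih =>
    refine .tail (ih (by omega) (by omega) (by omega)) ⟨?_, ?_, ?_, ⟨he, ?_, ?_, ?_⟩, ?_, ?_⟩ ?_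
    · simp; omega
    · simp; omega
    · simp; omega
    · simp; omega
    · simp
    · simp
    · simp; omega
    · simp; omega
    · have : o + k ≠ e + 1 := by omega
      simp [next, act, moved, this]; omega

/-- One round trip computes the bit of state `t`. -/
theorem run_pass {base : ℕ} {e t a : ℕ} {acc par flag : Bool} (he : e ≤ D.n) (ht : t < D.n)
    (ha : a ≤ D.m) (β : ℕ → Bool → Bool) (hL : base + D.n + shift D e ≤ L)  :
    ∃ acc', acc' = orBelow (fun s => old D e base β par s && D.T a s t) D.n ∧
    Run D x L base (base + D.n + 1) (2 * D.n + 2)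
      ⟨⟨.back, e, 0, t, a, acc, par, flag⟩, β, base⟩
      ⟨⟨.back, e, 0, t + 1, a, acc', par, flag || (acc' && D.F t)⟩,
        Function.update β (base + (t + 1 + shift D e))
            (Function.update (β (base + (t + 1 + shift D e))) (!par) acc'), base⟩ := by
  refine ⟨_, rfl, ?_⟩
  set acc' := orBelow (fun s => old D e base β par s && D.T a s t) D.n
  have hs : shift D e ≤ 1 := by unfold shift; split <;> omega
  have h1 : Run D x L base (base + D.n + 1) 1
      ⟨⟨.back, e, 0, t, a, acc, par, flag⟩, β, base⟩
      ⟨⟨.fwd, e, 1, t, a, false, par, flag⟩, β, base + 1⟩ := by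
    refine .single ⟨?_, ?_, ?_, ⟨he, ?_, ht.le, ha⟩, ?_, ?_⟩ ?_
    · simp
    · simp; omega
    · simp; omega
    · simp
    · simp
    · simp; omega
    · simp [next, act, moved, ht.ne]
  have h2 := run_fwd (x := x) (par := par) (flag := flag) he ht.le ha β (by omega : base + D.n ≤ L)
    D.n le_rfl
  have h3 : Run D x L base (base + D.n + 1) 1
      ⟨⟨.fwd, e, D.n + 1, t, a, acc', par, flag⟩, β, base + (D.n + 1)⟩
      ⟨⟨.back, e, D.n, t + 1, a, acc', par, flag || (acc' && D.F t)⟩,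
        Function.update β (base + (D.n + 1)) (if t + 1 + shift D e = D.n + 1 then
            Function.update (β (base + (D.n + 1))) (!par) acc' else β (base + (D.n + 1))),
        base + D.n⟩ := by
    refine .single ⟨?_, ?_, ?_, ⟨he, ?_, ht.le, ha⟩, ?_, ?_⟩ ?_
    · simp
    · simp; omega
    · simp; omega
    · simp
    · simp
    · simp
    · simp [next, act, moved, store, ← add_assoc]
  have h4 := run_back (x := x) (acc := acc') (par := par) (flag := flag || (acc' && D.F t)) he
    (by omega : t + 1 ≤ D.n) ha D.n (Function.update β (base + (D.n + 1))
      (if t + 1 + shift D e = D.n + 1 then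
            Function.update (β (base + (D.n + 1))) (!par) acc' else β (base + (D.n + 1))))
    (by omega) (by omega : base + D.n ≤ L)
  refine (((h1.trans h2).trans h3).trans h4).cast (by omega) ?_
  congr 1
  -- Position `n + 1` is the target only for the last state of a shifting window; that bit is stored
  -- at the turn, all others on the way back.
  by_cases h : t + 1 + shift D e = D.n + 1
  · rw [if_neg (by omega), if_pos h, h]
  · rw [if_neg h, Function.update_eq_self, if_pos (by omega)]

/-- The round trips for the first `t` states. -/
theorem run_passes {base : ℕ} {e a : ℕ} {par : Bool} (he : e ≤ D.n)
    (ha : a ≤ D.m) (β : ℕ → Bool → Bool) (hL : base + D.n + shift D e ≤ L) {new : ℕ → Bool}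
    (hnew : ∀ t, new t = orBelow (fun s => old D e base β par s && D.T a s t) D.n)
    (t : ℕ) (ht : t ≤ D.n) :
    ∃ acc' β', (∀ j, β' j par = β j par) ∧
      (∀ s < t, β' (base + (s + 1 + shift D e)) (!par) = new s) ∧
      Run D x L base (base + D.n + 1) (t * (2 * D.n + 2))
        ⟨⟨.back, e, 0, 0, a, false, par, false⟩, β, base⟩
        ⟨⟨.back, e, 0, t, a, acc', par, orBelow (fun s => new s && D.F s) t⟩, β', base⟩ := by
  induction t with
  | zero => exact ⟨false, β, fun _ => rfl, fun s hs => by omega, (Run.refl _).cast (by omega) rfl⟩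
  | succ t ih =>
    obtain ⟨acc, β', h1, h2, h3⟩ := ih (by omega)
    obtain ⟨acc', h4, h5⟩ := run_pass (x := x) (acc := acc) (par := par)
      (flag := orBelow (fun s => new s && D.F s) t) he (by omega : t < D.n) ha β' hL
    -- Earlier passes wrote only on track `!par`, so the old bits are still those of `β`.
    have h6 : acc' = new t := by
      rw [h4, hnew]
      refine orBelow_congr fun s _ => ?_
      simp only [old, h1]
    subst h6
    refine ⟨new t, _, fun j => ?_, fun s hs => ?_, (h3.trans h5).cast (by ring) rfl⟩
    · by_cases hj : j = base + (t + 1 + shift D e)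
      · subst hj
        simp [Function.update_of_ne, h1]
      · rw [Function.update_of_ne hj, h1]
    · by_cases hst : s = t
      · subst hst
        simp
      · rw [Function.update_of_ne (by omega), h2 s (by omega)]

/-- The sketch at which the letter in cell `i` is about to be processed. -/
structure Ready (D : NFATable) (x : ℕ → ℕ) (i : ℕ) (A : Sketch) : Prop where
  head : A.head = i
  ctl : ∃ par flag, A.ctl = ⟨.go, min (i - 1) D.n, min (i - 1) D.n + 1, 0, 0, false, par, flag⟩ ∧
    (1 < i → flag = orBelow (fun s => D.reach x (i - 1) s && D.F s) D.n) ∧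
    (1 < i → ∀ s < D.n, A.bits (i - min (i - 1) D.n + s) par = D.reach x (i - 1) s)

/-- A bound for the number of steps that process a letter. -/
def phaseTime (D : NFATable) : ℕ := D.n * (2 * D.n + 2) + 2 * D.n + 3

/-- Either the width grows by one or the window shifts by one. The step count is `1 + e` to reach
the left end, `n` passes, and `1 + (e + 1)` to reach the next letter. -/
theorem run_phase_aux {base e : ℕ} (he : e ≤ D.n) (hL : base + D.n + shift D e ≤ L)
    (hx : x (base + e + 1) ≤ D.m) (β : ℕ → Bool → Bool) (par flag : Bool) {new : ℕ → Bool}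
    (hnew : ∀ t, new t =
      orBelow (fun s => old D e base β par s && D.T (x (base + e + 1)) s t) D.n) :
    ∃ β', (∀ s < D.n, β' (base + (s + 1 + shift D e)) (!par) = new s) ∧
      Run D x L base (base + D.n + 1) (D.n * (2 * D.n + 2) + 2 * e + 3)
        ⟨⟨.go, e, e + 1, 0, 0, false, par, flag⟩, β, base + e + 1⟩
        ⟨⟨.go, min (e + 1) D.n, min (e + 1) D.n + 1, 0, 0, false, !par,
          orBelow (fun s => new s && D.F s) D.n⟩, β', base + e + 2⟩ := by
  have hs : shift D e ≤ 1 ∧ e + 1 = min (e + 1) D.n + shift D e := by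
    unfold shift; split <;> omega
  have hle : base + e + 1 ≤ L := by
    unfold shift at hL hs; split at hL <;> omega
  set a := x (base + e + 1) with ha
  have h1 : Run D x L base (base + D.n + 1) 1
      ⟨⟨.go, e, e + 1, 0, 0, false, par, flag⟩, β, base + e + 1⟩
      ⟨⟨.back, e, e, 0, a, false, par, false⟩, β, base + e⟩ := by
    refine .single ⟨?_, ?_, ?_, ⟨he, ?_, ?_, ?_⟩, ?_, ?_⟩ ?_
    · simp; omega
    · simp; omega
    · simp; omega
    · simp; omega
    · simp
    · simp
    · simp
    · simp; omega
    · simp [next, act, moved, ha]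
  have h2 := run_back (x := x) (acc := false) (par := par) (flag := false) he (Nat.zero_le D.n)
    hx e β (by omega) (by omega : base + e ≤ L)
  rw [if_neg (by omega)] at h2
  obtain ⟨acc, β', -, h3, h4⟩ := run_passes (x := x) he hx β hL hnew D.n le_rfl
  refine ⟨β', h3, ?_⟩
  have h5 : Run D x L base (base + D.n + 1) 1
      ⟨⟨.back, e, 0, D.n, a, acc, par, orBelow (fun s => new s && D.F s) D.n⟩, β', base⟩
      ⟨⟨.go, min (e + 1) D.n, 1 - shift D e, 0, 0, false, !par,
        orBelow (fun s => new s && D.F s) D.n⟩, β', base + shift D e + (1 - shift D e)⟩ := by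
    refine .single ⟨?_, ?_, ?_, ⟨he, ?_, le_rfl, hx⟩, ?_, ?_⟩ ?_
    · simp
    · simp; omega
    · simp; omega
    · simp
    · simp
    · simp; omega
    · simp [next, act, moved]; omega
  have h6 := run_go (D := D) (x := x) (L := L) (lo := base) (hi := base + D.n + 1) (par := !par)
    (flag := orBelow (fun s => new s && D.F s) D.n) (base := base + shift D e)
    (e := min (e + 1) D.n) (o := 1 - shift D e) (by omega) β' (e + 1) (by omega) (by omega)
    (by omega) (by omega)
  refine ((((h1.trans h2).trans h4).trans h5).trans h6).cast (by ring) ?_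
  congr 1
  · congr 1
    omega
  · omega

/-- For `i ≤ n` the base is `0` and the window fits because `n ≤ L`; for later `i` the window is the
`n` cells just before cell `i`. -/
theorem run_phase (hL : D.n ≤ L) {i : ℕ} (hi : 0 < i) (hiL : i ≤ L)
    (hx : x i ≤ D.m) {A : Sketch} (hA : Ready D x i A) :
    ∃ s B, s ≤ phaseTime D ∧ Ready D x (i + 1) B ∧
      Run D x L (i - (D.n + 1)) (i - (D.n + 1) + D.n + 1) s A B := by
  obtain ⟨r, β, h⟩ := A
  obtain ⟨h1, par, flag, h2, -, hbits⟩ := hA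
  dsimp only at h1 h2 hbits
  subst h2
  obtain rfl := h1.symm
  obtain ⟨base, e, he, hbase, rfl, hmin⟩ : ∃ base e, e ≤ D.n ∧ i - (D.n + 1) = base ∧
      i = base + e + 1 ∧ min (i - 1) D.n = e :=
    ⟨_, min (i - 1) D.n, by omega, rfl, by omega, rfl⟩
  rw [hmin, hbase]
  have hs : shift D e ≤ 1 ∧ e + 1 = min (e + 1) D.n + shift D e := by
    unfold shift; split <;> omega
  have hnew : ∀ t, D.reach x (base + e + 1) t =
      orBelow (fun s => old D e base β par s && D.T (x (base + e + 1)) s t) D.n := by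
    intro t
    rw [NFATable.reach]
    refine orBelow_congr fun s hs => ?_
    congr 1
    unfold old
    split_ifs with h0
    · have : base + e = 0 := by omega
      rw [this, NFATable.reach]
    · have := hbits (by omega) s hs
      rw [hmin] at this
      simp only [Nat.add_sub_cancel] at this
      rw [← this]
      congr 1
      omega
  obtain ⟨β', h1, h2⟩ := run_phase_aux (L := L) he (by omega) hx β par flag hnew
  have hmin' : min (base + e + 1 + 1 - 1) D.n = min (e + 1) D.n := by omega
  refine ⟨_, _, ?_, ⟨rfl, !par, _, ?_, fun _ => rfl, fun _ s hs' => ?_⟩, h2⟩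
  · unfold phaseTime; omega
  · rw [hmin']
    rfl
  · rw [hmin']
    simp only [Nat.add_sub_cancel]
    rw [← h1 s hs']
    congr 1
    omega

end SweepMachine

/-! ### Determinism of computations -/

namespace DetTM

variable {α Q Γ : Type*} {M : DetTM α Q Γ}

theorem ReachesIn.trans {s t : ℕ} {c d e : Config Q Γ} (h₁ : M.ReachesIn s c d)
    (h₂ : M.ReachesIn t d e) : M.ReachesIn (s + t) c e := by
  induction h₂ with
  | refl => exact h₁
  | tail _ hd ih => exact .tail (ih h₁) hd

theorem ReachesIn.head {t : ℕ} {c d e : Config Q Γ} (h₁ : M.step c = some d)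
    (h₂ : M.ReachesIn t d e) : M.ReachesIn (t + 1) c e := by
  rw [add_comm]
  exact ReachesIn.trans (.tail (.refl c) h₁) h₂

/-- The configuration after `t` steps, if the machine has not halted before. -/
def run (M : DetTM α Q Γ) (c : Config Q Γ) : ℕ → Option (Config Q Γ)
  | 0 => some c
  | t + 1 => (M.run c t).bind M.step

theorem ReachesIn.run_eq {t : ℕ} {c d : Config Q Γ} (h : M.ReachesIn t c d) :
    M.run c t = some d := by
  induction h with
  | refl => rfl
  | tail _ hd ih => rw [run, ih, Option.bind_some, hd]

theorem run_eq_none {c d : Config Q Γ} {s t : ℕ} (h : M.run c s = some d) (hd : M.Halting d)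
    (hst : s < t) : M.run c t = none := by
  induction t, hst using Nat.le_induction with
  | base => rw [run, h, Option.bind_some, hd]
  | succ t _ ih => rw [run, ih, Option.bind_none]

/-- The halting configuration is unique. -/
theorem halting_unique {s t : ℕ} {c d e : Config Q Γ} (h₁ : M.ReachesIn s c d) (hd : M.Halting d)
    (h₂ : M.ReachesIn t c e) (he : M.Halting e) : d = e := by
  have h₃ := h₁.run_eq
  have h₄ := h₂.run_eq
  rcases lt_trichotomy s t with h | rfl | h
  · simp [run_eq_none h₃ hd h] at h₄
  · exact Option.some_injective _ (h₃.symm.trans h₄)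
  · simp [run_eq_none h₄ he h] at h₃

end DetTM

/-! ### Decreasing weights imply linear time -/

namespace EndMarkedTM

variable {α Q Γ : Type*} {M : EndMarkedTM α Q Γ} {wt : Γ → ℕ} {L : ℕ}

/-- The head is on a tape that consists of the end-markers in cells `0` and `L + 1` and of inner
symbols in between. -/
structure Framed (M : EndMarkedTM α Q Γ) (L : ℕ) (c : DetTM.Config Q Γ) : Prop where
  head_nonneg : 0 ≤ c.head
  head_le : c.head ≤ L + 1
  zero : c.tape 0 = M.lend
  last : c.tape (L + 1) = M.rend
  inner : ∀ j : ℕ, j < L → c.tape (j + 1) ≠ M.lend ∧ c.tape (j + 1) ≠ M.rend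

/-- Each rewriting of an inner symbol produces an inner symbol of smaller weight. -/
def Reduces (M : EndMarkedTM α Q Γ) (wt : Γ → ℕ) : Prop :=
  ∀ p σ q τ d, σ ≠ M.lend → σ ≠ M.rend → M.δ p σ = some (q, τ, d) →
    τ ≠ M.lend ∧ τ ≠ M.rend ∧ wt τ < wt σ

/-- A bound for the number of steps from a configuration. -/
def potential (wt : Γ → ℕ) (L : ℕ) (c : DetTM.Config Q Γ) : ℕ :=
  2 * (∑ j ∈ Finset.range L, wt (c.tape (j + 1))) + if c.head = 0 ∨ c.head = L + 1 then 1 else 0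

theorem Reduces.weightReducing (h : M.Reduces wt) : M.WeightReducing := by
  refine ⟨fun τ σ => wt τ.1 < wt σ.1,
    { irrefl := fun _ => lt_irrefl _, trans := fun _ _ _ => lt_trans },
    fun p σ q τ d hδ => ?_⟩
  obtain ⟨h1, h2, h3⟩ := h p σ.1 q τ d σ.2.1 σ.2.2 hδ
  exact ⟨⟨τ, h1, h2⟩, rfl, h3⟩

/-- A step on an inner cell lowers the doubled sum by at least `2`, which pays for the extra `1` of
arriving at an end-marker. A step on an end-marker gives up that `1`, since `0 < L` puts an inner
cell next to it. -/
theorem Reduces.step (h : M.Reduces wt) (hL : 0 < L) {c d : DetTM.Config Q Γ} (hc : M.Framed L c)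
    (hd : M.step c = some d) : M.Framed L d ∧ potential wt L d < potential wt L c := by
  simp only [DetTM.step, Option.map_eq_some_iff, Prod.exists] at hd
  obtain ⟨q, τ, m, hδ, rfl⟩ := hd
  obtain ⟨h0, hle, hz, hl, hin⟩ := hc
  by_cases hhead : c.head = 0 ∨ c.head = L + 1
  · have hτ : τ = c.tape c.head ∧ c.head + m.offset ≠ 0 ∧ c.head + m.offset ≠ L + 1 ∧
        0 ≤ c.head + m.offset ∧ c.head + m.offset ≤ L + 1 := by
      rcases hhead with hh | hh
      · rw [hh, hz] at hδ
        obtain ⟨rfl, rfl⟩ := M.at_lend _ _ _ _ hδ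
        rw [hh, hz]
        refine ⟨rfl, ?_⟩
        simp [HeadMove.offset]
        omega
      · rw [hh, hl] at hδ
        obtain ⟨rfl, rfl⟩ := M.at_rend _ _ _ _ hδ
        rw [hh, hl]
        refine ⟨rfl, ?_⟩
        simp [HeadMove.offset]
        omega
    obtain ⟨rfl, h1, h2, h3, h4⟩ := hτ
    rw [Function.update_eq_self]
    refine ⟨⟨h3, h4, hz, hl, hin⟩, ?_⟩
    rw [potential, potential, if_pos hhead, if_neg (by tauto)]
    simp
  · obtain ⟨k, hk, hkL⟩ : ∃ k : ℕ, c.head = k + 1 ∧ k < L := by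
      refine ⟨(c.head - 1).toNat, ?_⟩
      omega
    rw [hk] at hδ
    obtain ⟨h1, h2, h3⟩ := h _ _ _ _ _ (hin k hkL).1 (hin k hkL).2 hδ
    have hm : m.offset = -1 ∨ m.offset = 1 := by cases m <;> simp [HeadMove.offset]
    have hlt : ∑ j ∈ Finset.range L, wt (Function.update c.tape c.head τ (j + 1)) <
        ∑ j ∈ Finset.range L, wt (c.tape (j + 1)) := by
      refine Finset.sum_lt_sum (fun j _ => ?_) ⟨k, Finset.mem_range.2 hkL, ?_⟩
      · by_cases hj : j = k
        · subst hj
          rw [hk, Function.update_self]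
          exact h3.le
        · rw [Function.update_of_ne (by omega)]
      · rw [hk, Function.update_self]
        exact h3
    refine ⟨⟨?_, ?_, ?_, ?_, fun j hj => ?_⟩, ?_⟩
    · dsimp only; omega
    · dsimp only; omega
    · dsimp only
      rw [Function.update_of_ne (by omega), hz]
    · dsimp only
      rw [Function.update_of_ne (by omega), hl]
    · dsimp only
      by_cases hjk : j = k
      · subst hjk
        rw [hk, Function.update_self]
        exact ⟨h1, h2⟩
      · rw [Function.update_of_ne (by omega)]
        exact hin j hj
    · unfold potential
      dsimp only
      split_ifs <;> omega

theorem Reduces.halts (h : M.Reduces wt) (hL : 0 < L) {c : DetTM.Config Q Γ}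
    (hc : M.Framed L c) :
    ∃ t d, t ≤ potential wt L c ∧ M.ReachesIn t c d ∧ M.Halting d := by
  induction hp : potential wt L c using Nat.strong_induction_on generalizing c with
  | _ p ih =>
    subst hp
    rcases hs : M.step c with _ | e
    · exact ⟨0, c, Nat.zero_le _, .refl c, hs⟩
    · obtain ⟨h1, h2⟩ := h.step hL hc hs
      obtain ⟨t, d, h3, h4, h5⟩ := ih _ h2 h1 rfl
      exact ⟨t + 1, d, by omega, h4.head hs, h5⟩

theorem init_tape_zero (w : List α) : (M.init w).tape 0 = M.lend := by
  simp [init, DetTM.configOn]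

theorem init_tape_last (w : List α) : (M.init w).tape (w.length + 1) = M.rend := by
  have h : (0 : ℤ) ≤ w.length + 1 := by omega
  have h' : ((w.length : ℤ) + 1).toNat = w.length + 1 := by omega
  simp [init, DetTM.configOn, h, h']

theorem init_tape_inner (w : List α) {j : ℕ} (hj : j < w.length) :
    (M.init w).tape (j + 1) = M.input w[j] := by
  have h : (0 : ℤ) ≤ j + 1 := by omega
  have h' : ((j : ℤ) + 1).toNat = j + 1 := by omega
  simp [init, DetTM.configOn, h, h', List.getElem?_append, hj]

theorem framed_init (w : List α) : M.Framed w.length (M.init w) where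
  head_nonneg := le_rfl
  head_le := by simp only [init, DetTM.configOn]; omega
  zero := init_tape_zero w
  last := init_tape_last w
  inner j hj := by
    rw [init_tape_inner w hj]
    exact ⟨M.lend_ne_input _, M.rend_ne_input _⟩

/-- A machine whose rewritings reduce a bounded weight is a weight-reducing Hennie machine if it
halts on the empty input. -/
theorem Reduces.isWeightReducingHennie (h : M.Reduces wt) {K : ℕ} (hK : ∀ a, wt (M.input a) ≤ K)
    (h0 : ∃ t c, M.ReachesIn t (M.init []) c ∧ M.Halting c) : M.IsWeightReducingHennie := by
  refine ⟨?_, h.weightReducing⟩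
  obtain ⟨t₀, c₀, h1, h2⟩ := h0
  -- The summand `t₀` serves the empty input only: there the end-markers are adjacent and no weight
  -- is spent.
  refine ⟨2 * K + 1 + t₀, fun w => ?_⟩
  rcases Nat.eq_zero_or_pos w.length with hw | hw
  · rw [List.length_eq_zero_iff] at hw
    subst hw
    exact ⟨t₀, c₀, by simp, h1, h2⟩
  · obtain ⟨t, d, h3, h4, h5⟩ := h.halts hw (framed_init w)
    refine ⟨t, d, h3.trans ?_, h4, h5⟩
    have h6 : ∑ j ∈ Finset.range w.length, wt ((M.init w).tape (j + 1)) ≤ w.length * K := by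
      refine (Finset.sum_le_card_nsmul _ _ K fun j hj => ?_).trans (by simp)
      rw [init_tape_inner w (Finset.mem_range.1 hj)]
      exact hK _
    have h7 : potential wt w.length (M.init w) ≤ 2 * (w.length * K) + 1 := by
      unfold potential
      split_ifs <;> omega
    refine h7.trans ?_
    nlinarith [Nat.zero_le (t₀ * (w.length + 1))]

end EndMarkedTM

/-! ### The finite machine -/

namespace SweepMachine

/-- The working symbols: a `cell` holds an input letter, two bits and a counter. -/
inductive Symb (m K : ℕ)
  | blank
  | lend
  | rend
  | letter (a : Fin m)
  | cell (a : Fin m) (b : Bool → Bool) (c : Fin (K + 1))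

namespace Symb

variable {m K : ℕ}

/-- An embedding into a sum type. -/
def code : Symb m K → Fin 3 ⊕ Fin m ⊕ Fin m × (Bool → Bool) × Fin (K + 1)
  | blank => .inl 0
  | lend => .inl 1
  | rend => .inl 2
  | letter a => .inr (.inl a)
  | cell a b c => .inr (.inr (a, b, c))

theorem code_injective : Function.Injective (code : Symb m K → _) := by
  rintro (_ | _ | _ | _ | _) (_ | _ | _ | _ | _) h <;> simp_all [code]

noncomputable instance : Fintype (Symb m K) := Fintype.ofInjective code code_injective

theorem card_le : Fintype.card (Symb m K) ≤ 3 + (m + m * (4 * (K + 1))) := by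
  refine (Fintype.card_le_of_injective code code_injective).trans ?_
  simp

/-- The remaining number of visits. -/
def weight : Symb m K → ℕ
  | letter _ => K + 1
  | cell _ _ c => c
  | _ => 0

/-- The letter, the bits and the counter of a symbol. -/
def view : Symb m K → Option (ℕ × (Bool → Bool) × ℕ)
  | letter a => some (a, fun _ => false, K + 1)
  | cell a b c => some (a, b, c)
  | _ => none

end Symb

/-- The finite type of control states. -/
abbrev State (D : NFATable) : Type :=
  Mode × Fin (D.n + 2) × Fin (D.n + 2) × Fin (D.n + 2) × Fin (D.m + 1) × Bool × Bool × Bool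

variable {D : NFATable}

/-- The state that represents a bounded control state. -/
def encode (D : NFATable) (r : Control) : State D :=
  (r.mode, Fin.ofNat _ r.width, Fin.ofNat _ r.pos, Fin.ofNat _ r.row, Fin.ofNat _ r.letter, r.acc,
    r.par, r.flag)

/-- The control state that is represented by a state. -/
def decode (q : State D) : Control :=
  ⟨q.1, q.2.1, q.2.2.1, q.2.2.2.1, q.2.2.2.2.1, q.2.2.2.2.2.1, q.2.2.2.2.2.2.1, q.2.2.2.2.2.2.2⟩

theorem decode_encode {r : Control} (h : Bounded D r) : decode (encode D r) = r := by
  obtain ⟨mode, width, pos, row, letter, acc, par, flag⟩ := r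
  obtain ⟨h1, h2, h3, h4⟩ := h
  dsimp only at h1 h2 h3 h4
  simp only [decode, encode, Fin.val_ofNat]
  rw [Nat.mod_eq_of_lt (by omega), Nat.mod_eq_of_lt (by omega), Nat.mod_eq_of_lt (by omega),
    Nat.mod_eq_of_lt (by omega)]

/-- The initial control state. -/
def startControl : Control := ⟨.go, 0, 0, 0, 0, false, false, false⟩

/-- The transition function. -/
def delta (D : NFATable) (K : ℕ) (q : State D) :
    Symb D.m K → Option (State D × Symb D.m K × HeadMove)
  | .blank => none
  | .lend =>
    match act D (decode q) 0 (fun _ => false) with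
    | (r, _, .right) => some (encode D r, .lend, .right)
    | _ => none
  -- Only a forward sweep may turn here. Reaching this marker while seeking a letter means that the
  -- input is exhausted, and the machine halts.
  | .rend =>
    match q.1, act D (decode q) 0 (fun _ => false) with
    | .fwd, (r, _, .left) => some (encode D r, .rend, .left)
    | _, _ => none
  -- An unvisited letter behaves as a cell with both bits false and counter `K + 1`.
  | .letter a =>
    some (encode D (act D (decode q) a fun _ => false).1,
      .cell a (act D (decode q) a fun _ => false).2.1 (Fin.last K),
      (act D (decode q) a fun _ => false).2.2)
  | .cell a b c =>
    if 0 < c.val then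
      some (encode D (act D (decode q) a b).1,
        .cell a (act D (decode q) a b).2.1 ⟨c.val - 1, by omega⟩,
        (act D (decode q) a b).2.2)
    else none

variable {α : Type*} {K : ℕ}

/-- The machine that simulates the automaton `D`. -/
def machine (D : NFATable) (K : ℕ) (f : α ≃ Fin D.m) : EndMarkedTM α (State D) (Symb D.m K) where
  input := ⟨fun a => .letter (f a), fun a b h => by simpa using h⟩
  blank := .blank
  blank_ne_input _ := by simp
  start := encode D startControl
  final := {q | (decode q).flag = true}
  δ := delta D K
  write_ne_blank p σ q τ d h := by
    rintro rfl
    rcases σ with _ | _ | _ | a | ⟨a, b, c⟩ <;> simp only [delta] at h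
    · simp at h
    · split at h <;> simp at h
    · split at h <;> simp at h
    · simp at h
    · split at h <;> simp at h
  lend := .lend
  rend := .rend
  lend_ne_rend := by simp
  lend_ne_blank := by simp
  rend_ne_blank := by simp
  lend_ne_input _ := by simp
  rend_ne_input _ := by simp
  at_lend p q τ d h := by
    simp only [delta] at h
    split at h <;> simp at h
    exact ⟨h.2.1.symm, h.2.2.symm⟩
  at_rend p q τ d h := by
    simp only [delta] at h
    split at h <;> simp at h
    exact ⟨h.2.1.symm, h.2.2.symm⟩

variable {f : α ≃ Fin D.m}

theorem machine_reduces : (machine D K f).Reduces Symb.weight := by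
  intro p σ q τ d h1 h2 h
  simp only [machine] at h h1 h2 ⊢
  rcases σ with _ | _ | _ | a | ⟨a, b, c⟩ <;> simp only [delta] at h
  · simp at h
  · exact absurd rfl h1
  · exact absurd rfl h2
  · simp only [Option.some.injEq, Prod.mk.injEq] at h
    obtain ⟨-, rfl, -⟩ := h
    simp [Symb.weight]
  · split at h
    · simp only [Option.some.injEq, Prod.mk.injEq] at h
      obtain ⟨-, rfl, -⟩ := h
      simp only [Symb.weight]
      refine ⟨by simp, by simp, by omega⟩
    · simp at h

theorem bounded_startControl : Bounded D startControl := by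
  constructor <;> simp [startControl]

/-- The first step from the left end-marker. -/
theorem delta_start : delta D K (encode D startControl) .lend =
    some (encode D ⟨.go, 0, 1, 0, 0, false, false, false⟩, .lend, .right) := by
  simp only [delta, decode_encode bounded_startControl]
  simp [startControl, act]

theorem delta_rend_of_ne {q : State D} (h : q.1 ≠ .fwd) : delta D K q .rend = none := by
  simp only [delta]
  split
  · contradiction
  · rfl

theorem delta_of_view {r : Control} (hr : Bounded D r) {σ : Symb D.m K} {a k : ℕ}
    {b : Bool → Bool} (h : σ.view = some (a, b, k)) (hk : 0 < k) :
    ∃ τ : Symb D.m K, delta D K (encode D r) σ =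
      some (encode D (act D r a b).1, τ, (act D r a b).2.2) ∧
      τ.view = some (a, (act D r a b).2.1, k - 1) := by
  rcases σ with _ | _ | _ | a | ⟨a, b, c⟩ <;> simp only [Symb.view] at h
  · simp at h
  · simp at h
  · simp at h
  · simp only [Option.some.injEq, Prod.mk.injEq] at h
    obtain ⟨rfl, rfl, rfl⟩ := h
    exact ⟨_, by rw [delta, decode_encode hr], by simp [Symb.view]⟩
  · simp only [Option.some.injEq, Prod.mk.injEq] at h
    obtain ⟨rfl, rfl, rfl⟩ := h
    exact ⟨_, by rw [delta, decode_encode hr, if_pos hk], by simp [Symb.view]⟩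

/-! ### Simulation of sketches by the machine -/

/-- The configuration `P` refines the sketch `A`, and the counters are at least `c`. -/
structure Refines (D : NFATable) (K : ℕ) (x : ℕ → ℕ) (L : ℕ) (c : ℕ → ℕ) (A : Sketch)
    (P : DetTM.Config (State D) (Symb D.m K)) : Prop where
  state : P.state = encode D A.ctl
  head : P.head = A.head
  zero : P.tape 0 = .lend
  last : P.tape (L + 1 : ℕ) = .rend
  inner : ∀ j, 0 < j → j ≤ L → ∃ k, c j ≤ k ∧ (P.tape j).view = some (x j, A.bits j, k)

variable {x : ℕ → ℕ} {L lo hi : ℕ}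

theorem Refines.mono {c c' : ℕ → ℕ} {A : Sketch} {P : DetTM.Config (State D) (Symb D.m K)}
    (h : Refines D K x L c A P) (hc : ∀ j, c' j ≤ c j) : Refines D K x L c' A P :=
  ⟨h.state, h.head, h.zero, h.last, fun j h0 hj =>
    let ⟨k, hk, hv⟩ := h.inner j h0 hj
    ⟨k, (hc j).trans hk, hv⟩⟩

/-- On an inner cell the positive counter enables the transition; on an end-marker `Ok` makes the
contents of the sketch there irrelevant. -/
theorem Refines.step {c : ℕ → ℕ} {A : Sketch} {P : DetTM.Config (State D) (Symb D.m K)}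
    (h : Refines D K x L c A P) (hA : Ok D L lo hi A) (hc : 0 < c A.head) :
    ∃ P', (machine D K f).step P = some P' ∧
      Refines D K x L (Function.update c A.head (c A.head - 1)) (next D x A) P' := by
  obtain ⟨q, tape, head⟩ := P
  obtain ⟨h1, h2, h3, h4, h5⟩ := h
  dsimp only at h1 h2 h3 h4 h5
  subst h1 h2
  have hstep : ∀ τ r d, delta D K (encode D A.ctl) (tape A.head) = some (r, τ, d) →
      (machine D K f).step ⟨encode D A.ctl, tape, A.head⟩ =
        some ⟨r, Function.update tape A.head τ, A.head + d.offset⟩ := by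
    intro τ r d hδ
    simp [DetTM.step, machine, hδ]
  have hb : Function.update A.bits A.head (act D A.ctl (x A.head) (A.bits A.head)).2.1 =
    (next D x A).bits := rfl
  rcases Nat.eq_zero_or_pos A.head with h0 | h0
  · obtain ⟨hpos, hmode⟩ := hA.at_zero h0
    have hδ : (act D A.ctl (x A.head) (A.bits A.head)).2.2 = .right ∧
        delta D K (encode D A.ctl) .lend =
          some (encode D (act D A.ctl (x A.head) (A.bits A.head)).1, .lend, .right) := by
      simp only [delta, decode_encode hA.bounded]
      rcases hm : A.ctl.mode
      · simp [act, hm, hpos]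
      · exact absurd hm hmode
      · by_cases hrow : A.ctl.row = D.n <;> simp [act, hm, hpos, hrow]
    have htape : tape A.head = .lend := by rw [h0]; exact h3
    have hup : Function.update tape A.head .lend = tape := by
      rw [← htape, Function.update_eq_self]
    refine ⟨_, hstep .lend _ .right (by rw [htape]; exact hδ.2), rfl, ?_, ?_, ?_, ?_⟩
    · simp [next, hδ.1, moved, HeadMove.offset]
    · dsimp only; rw [hup]; exact h3
    · dsimp only; rw [hup]; exact h4
    · intro j hj0 hj
      dsimp only
      rw [hup, ← hb, Function.update_of_ne (by omega),
        Function.update_of_ne (by omega)]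
      exact h5 j hj0 hj
  rcases Nat.lt_or_ge L A.head with hL | hL
  · have hhead : A.head = L + 1 := le_antisymm hA.le_end hL
    obtain ⟨hmode, hpos⟩ := hA.at_end hhead
    have hδ : (act D A.ctl (x A.head) (A.bits A.head)).2.2 = .left ∧
        delta D K (encode D A.ctl) .rend =
          some (encode D (act D A.ctl (x A.head) (A.bits A.head)).1, .rend, .left) := by
      have : (encode D A.ctl).1 = .fwd := hmode
      simp only [delta, decode_encode hA.bounded, this]
      simp [act, hmode, not_le.2 hpos]
    have htape : tape A.head = .rend := by rw [hhead]; exact h4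
    have hup : Function.update tape A.head .rend = tape := by
      rw [← htape, Function.update_eq_self]
    refine ⟨_, hstep .rend _ .left (by rw [htape]; exact hδ.2), rfl, ?_, ?_, ?_, ?_⟩
    · simp [next, hδ.1, moved, HeadMove.offset]; omega
    · dsimp only; rw [hup]; exact h3
    · dsimp only; rw [hup]; exact h4
    · intro j hj0 hj
      dsimp only
      rw [hup, ← hb, Function.update_of_ne (by omega),
        Function.update_of_ne (by omega)]
      exact h5 j hj0 hj
  · obtain ⟨k, hk, hv⟩ := h5 A.head h0 hL
    obtain ⟨τ, hδ, hτ⟩ := delta_of_view hA.bounded hv (hc.trans_le hk)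
    refine ⟨_, hstep τ _ _ hδ, rfl, ?_, ?_, ?_, ?_⟩
    · simp only [next]
      cases (act D A.ctl (x A.head) (A.bits A.head)).2.2 <;> simp [moved, HeadMove.offset]
      omega
    · dsimp only
      rw [Function.update_of_ne (by omega)]; exact h3
    · dsimp only
      rw [Function.update_of_ne (by omega)]; exact h4
    · intro j hj0 hj
      rw [← hb]
      by_cases hjh : j = A.head
      · subst hjh
        simp only [Function.update_self]
        exact ⟨k - 1, by omega, hτ⟩
      · dsimp only
        rw [Function.update_of_ne (by omega : (j : ℤ) ≠ A.head), Function.update_of_ne hjh,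
          Function.update_of_ne hjh]
        exact h5 j hj0 hj

/-- The accounting is coarse: every cell in the range of the run is charged for all of its steps, so
only the length and the range matter. -/
theorem Refines.run {c : ℕ → ℕ} {A B : Sketch} {P : DetTM.Config (State D) (Symb D.m K)} {s : ℕ}
    (h : Refines D K x L c A P) (hR : Run D x L lo hi s A B)
    (hc : ∀ j, lo ≤ j → j ≤ hi → s ≤ c j) :
    ∃ P', (machine D K f).ReachesIn s P P' ∧
      Refines D K x L (fun j => if lo ≤ j ∧ j ≤ hi then c j - s else c j) B P' := by
  induction hR with
  | refl => exact ⟨P, .refl P, h.mono fun j => by split_ifs <;> omega⟩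
  | @tail s A B C _ hB hC ih =>
    subst hC
    obtain ⟨P', h1, h2⟩ := ih h fun j hj hj' => by have := hc j hj hj'; omega
    have hpos := hc B.head hB.lo_le hB.le_hi
    obtain ⟨P'', h3, h4⟩ := h2.step (f := f) hB
      (by rw [if_pos ⟨hB.lo_le, hB.le_hi⟩]; omega)
    refine ⟨P'', .tail h1 h3, h4.mono fun j => ?_⟩
    by_cases hj : j = B.head
    · subst hj
      rw [Function.update_self, if_pos ⟨hB.lo_le, hB.le_hi⟩, if_pos ⟨hB.lo_le, hB.le_hi⟩]
      omega
    · rw [Function.update_of_ne hj]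
      split_ifs <;> omega

/-! ### The counters suffice -/

/-- The initial value of the counters. -/
def capacity (D : NFATable) : ℕ := phaseTime D * (2 * D.n + 4)

/-- A lower bound for the counter of cell `j` before the letter of cell `i` is processed. -/
def reserve (D : NFATable) (i j : ℕ) : ℕ :=
  -- Cell `j` is out of reach once `i > j + n + 1`, so at most `j + n + 2 - i` phases remain to be
  -- paid for. The cap keeps the reserve within `capacity D`.
  phaseTime D * min (2 * D.n + 4) (j + (D.n + 2) - i)

/-- For such `j` at most `2n + 2` phases remain, so the cap is inactive. -/
theorem reserve_succ_add (i j : ℕ) (h₁ : i ≤ j + D.n + 1) (h₂ : j ≤ i + D.n) :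
    reserve D (i + 1) j + phaseTime D = reserve D i j := by
  unfold reserve
  rw [← Nat.mul_succ]
  congr 1
  omega

theorem reserve_succ_le (i j : ℕ) : reserve D (i + 1) j ≤ reserve D i j := by
  unfold reserve
  gcongr
  omega

/-- The letters of the word `w` in the cells `1, 2, …`. -/
def letters (f : α ≃ Fin D.m) (w : List α) (j : ℕ) : ℕ :=
  (w[j - 1]?).elim 0 fun a => f a

theorem letters_le (w : List α) (j : ℕ) : letters f w j ≤ D.m := by
  unfold letters
  cases w[j - 1]? with
  | none => simp
  | some a => exact (f a).2.le

theorem init_step (w : List α) : ∃ P, (machine D (capacity D) f).step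
    ((machine D (capacity D) f).init w) = some P ∧
      Refines D (capacity D) (letters f w) w.length (reserve D 1)
        ⟨⟨.go, 0, 1, 0, 0, false, false, false⟩, fun _ _ => false, 1⟩ P := by
  set M := machine D (capacity D) f
  have h0 : (M.init w).tape (M.init w).head = .lend := EndMarkedTM.init_tape_zero w
  have h1 : M.step (M.init w) = some ⟨encode D ⟨.go, 0, 1, 0, 0, false, false, false⟩,
      (M.init w).tape, 1⟩ := by
    have h2 : M.δ (M.init w).state .lend =
      some (encode D ⟨.go, 0, 1, 0, 0, false, false, false⟩, .lend, .right) := delta_start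
    rw [DetTM.step, h0, h2, ← h0]
    simp [HeadMove.offset]
    rfl
  refine ⟨_, h1, rfl, rfl, EndMarkedTM.init_tape_zero w, ?_, fun j hj0 hj => ?_⟩
  · have := EndMarkedTM.init_tape_last (M := M) w
    push_cast
    exact this
  · obtain ⟨j, rfl⟩ : ∃ i, j = i + 1 := ⟨j - 1, by omega⟩
    have := EndMarkedTM.init_tape_inner (M := M) w (j := j) (by omega)
    refine ⟨capacity D + 1, ?_, ?_⟩
    · refine (Nat.mul_le_mul_left (phaseTime D) (min_le_left _ _)).trans ?_
      exact Nat.le_succ _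
    · push_cast
      rw [this]
      simp [M, machine, Symb.view, letters, List.getElem?_eq_getElem (show j < w.length by omega)]
      rfl

/-- The range of a phase consists of cells whose reserve drops by exactly `phaseTime D`, an upper
bound for its length, so no counter runs out. -/
theorem reaches_ready (w : List α) (hw : D.n ≤ w.length) (i : ℕ) (hi : i ≤ w.length) :
    ∃ t P A, (machine D (capacity D) f).ReachesIn t ((machine D (capacity D) f).init w) P ∧
      Ready D (letters f w) (i + 1) A ∧
      Refines D (capacity D) (letters f w) w.length (reserve D (i + 1)) A P := by
  induction i with
  | zero =>
    obtain ⟨P, h1, h2⟩ := init_step (D := D) (f := f) w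
    exact ⟨1, P, _, .tail (.refl _) h1, ⟨rfl, false, false, by simp, by simp, by simp⟩, h2⟩
  | succ i ih =>
    obtain ⟨t, P, A, h1, h2, h3⟩ := ih (by omega)
    obtain ⟨s, B, h4, h5, h6⟩ := run_phase hw (by omega : 0 < i + 1) hi (letters_le w _) h2
    obtain ⟨P', h7, h8⟩ := h3.run (f := f) h6 fun j hj hj' => by
      have := reserve_succ_add (D := D) (i + 1) j (by omega) (by omega)
      omega
    refine ⟨_, P', B, h1.trans h7, h5, h8.mono fun j => ?_⟩
    split_ifs with hj
    · have := reserve_succ_add (D := D) (i + 1) j (by omega) (by omega)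
      omega
    · exact reserve_succ_le _ _

/-- The weights alone give termination; only the empty word needs a look at the computation, which
halts on the right end-marker after one step. -/
theorem machine_isWeightReducingHennie :
    (machine D (capacity D) f).IsWeightReducingHennie := by
  refine machine_reduces.isWeightReducingHennie (K := capacity D + 1) (fun a => le_rfl) ?_
  obtain ⟨P, h1, h2⟩ := init_step (D := D) (f := f) []
  refine ⟨1, P, .tail (.refl _) h1, ?_⟩
  have h3 : P.tape P.head = .rend := by rw [h2.head]; exact h2.last
  have h4 : delta D (capacity D) P.state .rend = none := by
    rw [h2.state]
    exact delta_rend_of_ne (by simp [encode])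
  rw [DetTM.Halting, DetTM.step, h3]
  simp [machine, h4]

/-- After the last letter the machine halts on the right end-marker with the answer in `flag`; `0 <
D.n` makes the word nonempty, so `flag` has been computed. Determinism excludes any other halting
configuration. -/
theorem machine_accepts_iff (hn : 0 < D.n) (w : List α) (hw : D.n ≤ w.length) :
    (machine D (capacity D) f).Accepts w ↔
      ∃ s < D.n, D.reach (letters f w) w.length s = true ∧ D.F s = true := by
  obtain ⟨t, P, A, h1, h2, h3⟩ := reaches_ready (D := D) (f := f) w hw w.length le_rfl
  obtain ⟨hhead, par, flag, hctl, hflag, -⟩ := h2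
  rw [Nat.add_sub_cancel] at hctl hflag
  have hb : Bounded D A.ctl := by
    rw [hctl]
    constructor <;> simp
  have h4 : P.tape P.head = .rend := by rw [h3.head, hhead]; exact h3.last
  have h5 : delta D (capacity D) P.state .rend = none := by
    rw [h3.state, hctl]
    exact delta_rend_of_ne (by simp [encode])
  have h6 : (machine D (capacity D) f).Halting P := by
    rw [DetTM.Halting, DetTM.step, h4]
    simp [machine, h5]
  have h7 : P.state ∈ (machine D (capacity D) f).final ↔ flag = true := by
    change (decode P.state).flag = true ↔ _
    rw [h3.state, decode_encode hb, hctl]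
  rw [hflag (by omega), orBelow_eq_true] at h7
  simp only [Bool.and_eq_true] at h7
  rw [← h7]
  constructor
  · rintro ⟨t', P', h8, h9, h10⟩
    rwa [DetTM.halting_unique h1 h6 h8 h9]
  · exact fun h => ⟨t, P, h1, h6, h⟩

/-- The factor `24` counts three modes and three Boolean flags. Logarithms are bounded by their
arguments to get a polynomial. -/
theorem size_machine_le : (machine D K f).size ≤
    (24 * (D.n + 2) ^ 3 * (D.m + 1)) * (3 + (D.m + D.m * (4 * (K + 1)))) *
      (2 + 24 * (D.n + 2) ^ 3 * (D.m + 1) + (3 + (D.m + D.m * (4 * (K + 1))))) +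
      24 * (D.n + 2) ^ 3 * (D.m + 1) + 24 * (D.n + 2) ^ 3 * (D.m + 1) +
      (3 + (D.m + D.m * (4 * (K + 1)))) := by
  have hQ : Fintype.card (State D) = 24 * (D.n + 2) ^ 3 * (D.m + 1) := by
    have : Fintype.card Mode = 3 := rfl
    simp only [Fintype.card_prod, Fintype.card_fin, Fintype.card_bool, this]
    ring
  have hΓ := Symb.card_le (m := D.m) (K := K)
  have hclog : ∀ k : ℕ, Nat.clog 2 k ≤ k := fun k =>
    Nat.clog_le_of_le_pow Nat.lt_two_pow_self.le
  have h1 := hclog (Fintype.card (State D))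
  have h2 := (hclog (Fintype.card (Symb D.m K))).trans hΓ
  unfold DetTM.size
  rw [hQ] at h1 ⊢
  gcongr

end SweepMachine

/-! ### From abstract automata to tables -/

/-- The table of an automaton, for numberings of its states and letters. -/
noncomputable def NFA.table {α S : Type*} [Fintype α] [Fintype S] (A : NFA α S) (q₀ : S)
    (f : α ≃ Fin (Fintype.card α)) (g : S ≃ Fin (Fintype.card S)) : NFATable := by
  classical
  exact
  { n := Fintype.card S
    m := Fintype.card α
    q₀ := g q₀
    T := fun a s t => decide (∃ a' s' t', a = f a' ∧ s = g s' ∧ t = g t' ∧ t' ∈ A.step s' a')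
    F := fun s => decide (∃ s', s = g s' ∧ s' ∈ A.accept) }

theorem NFA.reach_table {α S : Type*} [Fintype α] [Fintype S] (A : NFA α S) {q₀ : S}
    (h₀ : A.start = {q₀}) (f : α ≃ Fin (Fintype.card α)) (g : S ≃ Fin (Fintype.card S))
    (w : List α) (i : ℕ) (hi : i ≤ w.length) (s : S) :
    (A.table q₀ f g).reach (SweepMachine.letters (D := A.table q₀ f g) f w) i (g s) = true ↔
      s ∈ A.eval (w.take i) := by
  induction i generalizing s with
  | zero =>
    simp [NFATable.reach, table, NFA.eval, h₀, ← Fin.ext_iff]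
  | succ i ih =>
    have hl : SweepMachine.letters (D := A.table q₀ f g) f w (i + 1) = f w[i] := by
      simp [SweepMachine.letters, List.getElem?_eq_getElem (show i < w.length by omega)]
      rfl
    rw [NFATable.reach, orBelow_eq_true, List.take_succ_eq_append_getElem (by omega),
      NFA.eval_append_singleton, NFA.mem_stepSet, hl]
    constructor
    · rintro ⟨k, hk, h⟩
      obtain ⟨s', hs'⟩ := g.surjective ⟨k, hk⟩
      obtain rfl : (g s' : ℕ) = k := by rw [hs']
      rw [Bool.and_eq_true, ih (by omega)] at h
      obtain ⟨h1, h2⟩ := h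
      simp only [table, decide_eq_true_eq, Fin.val_inj, EmbeddingLike.apply_eq_iff_eq] at h2
      obtain ⟨_, _, _, rfl, rfl, rfl, h2⟩ := h2
      exact ⟨_, h1, h2⟩
    · rintro ⟨s', h1, h2⟩
      refine ⟨g s', (g s').2, ?_⟩
      rw [Bool.and_eq_true, ih (by omega)]
      refine ⟨h1, ?_⟩
      simp only [table, decide_eq_true_eq]
      exact ⟨_, _, _, rfl, rfl, rfl, h2⟩

theorem mainTheorem5 :
    ∃ P : MvPolynomial (Fin 2) ℕ,
      ∀ (α : Type*) (S : Type*) [Fintype α] [Fintype S] (A : NFA α S) (q₀ : S),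
        A.start = {q₀} →
        ∃ (Q Γ : Type) (_ : Fintype Q) (_ : Fintype Γ) (M : EndMarkedTM α Q Γ),
          M.IsWeightReducingHennie ∧
          M.size ≤ MvPolynomial.eval ![Fintype.card S, Fintype.card α] P ∧
          ∀ w : List α, Fintype.card S ≤ w.length → (M.Accepts w ↔ w ∈ A.accepts) := by
  let n : MvPolynomial (Fin 2) ℕ := .X 0
  let m : MvPolynomial (Fin 2) ℕ := .X 1
  -- These mirror `capacity D` and the bounds for the numbers of states and symbols in
  -- `size_machine_le`.
  let K := (n * (2 * n + 2) + 2 * n + 3) * (2 * n + 4)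
  let q := 24 * (n + 2) ^ 3 * (m + 1)
  let g := 3 + (m + m * (4 * (K + 1)))
  refine ⟨q * g * (2 + q + g) + q + q + g, fun α S _ _ A q₀ h₀ => ?_⟩
  let eα := Fintype.equivFin α
  let eS := Fintype.equivFin S
  let D := A.table q₀ eα eS
  refine ⟨SweepMachine.State D, SweepMachine.Symb D.m (SweepMachine.capacity D), inferInstance,
    inferInstance, SweepMachine.machine D (SweepMachine.capacity D) eα,
    SweepMachine.machine_isWeightReducingHennie, SweepMachine.size_machine_le.trans_eq ?_,
    fun w hw => ?_⟩
  · simp [q, g, K, n, m, D, NFA.table, SweepMachine.capacity, SweepMachine.phaseTime]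
  · have hn : 0 < D.n := Fintype.card_pos_iff.2 ⟨q₀⟩
    refine (SweepMachine.machine_accepts_iff hn w hw).trans ?_
    rw [NFA.mem_accepts]
    have hreach : ∀ s, D.reach (SweepMachine.letters (D := D) eα w) w.length (eS s) = true ↔
        s ∈ A.eval w := by
      intro s
      rw [A.reach_table h₀ eα eS w w.length le_rfl s, List.take_length]
    constructor
    · rintro ⟨k, hk, h1, h2⟩
      simp only [D, NFA.table, decide_eq_true_eq] at h2
      obtain ⟨s, rfl, h2⟩ := h2
      exact ⟨s, h2, (hreach s).1 h1⟩
    · rintro ⟨s, h1, h2⟩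
      refine ⟨eS s, (eS s).2, (hreach s).2 h2, ?_⟩
      simp only [D, NFA.table, decide_eq_true_eq]
      exact ⟨s, rfl, h1⟩
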